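/- There exist real numbers $a>0$ and $\bar s>0$ and functions $u,v:[0,\bar s]\to\mathbb R$ of class $C^2([0,\bar s])$ (with one-sided derivatives at the end points) such that $$ \begin{cases} u'' = -v'^2\left(u-\frac1u\right)+u'v'v\\[2pt] v'' = v'u'\left(u-\frac1u\right)-u'^2v \end{cases} \qquad\text{on }(0,\bar s], $$ and such that the curve $(u,v)$ has the following properties: * $u(0)=0$, $v(0)=a$, $u'(0)=1$, $v'(0)=0$ (it starts on the vertical axis with horizontal tangent); * $u(\bar s)>0$, $v(\bar s)=0$, $u'(\bar s)=\frac12$, $v'(\bar s)=-\frac{\sqrt3}{2}$ (it reaches the horizontal axis forming an angle of $60$ degrees); * $u(s)>0$ and $v(s)>0$ for all $s\in(0,\bar s)$, and the curve does not self-intersect, that is, $s\mapsto(u(s),v(s))$ is injective on $[0,\bar s]$. -/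

import Mathlib

/-- The functions `u` and `v` solve, at every point `s` of `(0, L]`, the degenerate system
`u'' = -v'² (u - 1/u) + u' v' v`, `v'' = v' u' (u - 1/u) - u'² v`.
The functions are considered on `[0, L]` only: all derivatives are taken within `[0, L]`, so they
are the usual ones in the interior and one-sided at the end points. -/
def SolvesProfileSystem (L : ℝ) (u v : ℝ → ℝ) : Prop :=
  ∀ s ∈ Set.Ioc 0 L,
    derivWithin (derivWithin u (Set.Icc 0 L)) (Set.Icc 0 L) s =
        -(derivWithin v (Set.Icc 0 L) s) ^ 2 * (u s - 1 / u s)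
          + derivWithin u (Set.Icc 0 L) s * derivWithin v (Set.Icc 0 L) s * v s ∧
    derivWithin (derivWithin v (Set.Icc 0 L)) (Set.Icc 0 L) s =
        derivWithin v (Set.Icc 0 L) s * derivWithin u (Set.Icc 0 L) s * (u s - 1 / u s)
          - (derivWithin u (Set.Icc 0 L) s) ^ 2 * v s

/-!
A curve of unit speed that makes an angle `θ` with the horizontal solves the system if and only if
`θ' = sin θ (u - 1/u) - v cos θ`. While the curve is a graph `v = f(u)`,
the function `q(u) = sin θ` satisfies `(u q)' = u (u q - f cos θ)` and `f' = tan θ`. This divergence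
form removes the singularity on the axis: writing `h = u q - f cos θ`, one has
`q(u) = u ∫₀¹ τ h(u τ) dτ`.

Since only angles between `-60°` and `0` matter, the sine is truncated to `[-√3/2, √3/2]` in
`cos θ` and `tan θ`. The integral operator is then globally Lipschitz of Volterra type, so it is a
contraction for the sup norm with weight `exp (-l u)`, `l` large. This gives, for every initial
height `a ∈ [0, 6]`, a profile over `[0, 10]` that depends continuously on `a`
(`exists_clippedProfile_family`).

For `a > 0` the angle is strictly decreasing (`IsClippedProfile.deriv_sin_neg`), hence the profile
is concave and strictly decreasing, and it is negative at `u = 10`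
(`IsClippedProfile.height_ten_neg`). For `a = 6` the angle reaches `-60°` at positive height, and
for small `a` the profile is nearly horizontal when it reaches the horizontal axis. By monotonicity
of height and angle these two behaviours exclude each other, and both are open conditions on `a`, so
for some `a` both events take place at the same point `z` (`exists_clippedProfile_angle`). Up to `z`
the truncation has no effect. Inverting `∫ du / cos θ` parametrizes the profile by arc length; the
curve is embedded because `u` is strictly increasing.
-/

/-! ### Fixed points of Volterra operators -/

/-- `T` is Lipschitz on `[0, R]` for all the weighted sup norms with weight `exp (-l t)`, `1 ≤ l`,
with a constant `K / l` that is small for large `l`. -/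
def VolterraBound (R K : ℝ) (T : (ℝ → ℝ) → ℝ → ℝ) : Prop :=
  ∀ p q : ℝ → ℝ, Continuous p → Continuous q → ∀ l : ℝ, 1 ≤ l → ∀ D : ℝ, 0 ≤ D →
    (∀ t ∈ Set.Icc 0 R, |p t - q t| ≤ D * Real.exp (l * t)) →
    ∀ t ∈ Set.Icc 0 R, |T p t - T q t| ≤ K / l * D * Real.exp (l * t)

theorem VolterraBound.exists_fixedPoint {R K : ℝ} {T : (ℝ → ℝ) → ℝ → ℝ} (hR : 0 ≤ R)
    (hK : 0 ≤ K) (hT : VolterraBound R K T) (hcont : ∀ q, Continuous q → Continuous (T q)) :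
    ∃ q : ℝ → ℝ, Continuous q ∧ ∀ t ∈ Set.Icc 0 R, T q t = q t := by
  set l : ℝ := 2 * K + 1 with hl
  have hl1 : 1 ≤ l := by linarith
  have hKl : K / l ≤ 1 / 2 := by
    rw [div_le_div_iff₀ (by linarith) (by norm_num)]; linarith
  -- the unknown is `x = exp (-l t) q`, for which the operator contracts the plain sup norm
  let E : C(Set.Icc (0 : ℝ) R, ℝ) → ℝ → ℝ := fun x t => Real.exp (l * t) * Set.IccExtend hR x t
  have hE : ∀ x, Continuous (E x) := fun x =>
    (by fun_prop : Continuous fun t => Real.exp (l * t)).mul (x.continuous.Icc_extend' (h := hR))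
  let Φ : C(Set.Icc (0 : ℝ) R, ℝ) → C(Set.Icc (0 : ℝ) R, ℝ) := fun x =>
    ⟨fun t => Real.exp (-(l * (t : ℝ))) * T (E x) t,
      (by fun_prop : Continuous fun t : Set.Icc (0 : ℝ) R => Real.exp (-(l * (t : ℝ)))).mul
        ((hcont _ (hE x)).comp continuous_subtype_val)⟩
  have hΦ : ContractingWith (1 / 2 : NNReal) Φ := by
    refine ⟨by rw [← NNReal.coe_lt_coe]; norm_num, LipschitzWith.of_dist_le_mul fun x y => ?_⟩
    have hpos : 0 ≤ ((1 / 2 : NNReal) : ℝ) * dist x y := by positivity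
    rw [ContinuousMap.dist_le hpos]
    intro t
    have h1 : ∀ s ∈ Set.Icc 0 R, |E x s - E y s| ≤ dist x y * Real.exp (l * s) := by
      intro s hs
      have h2 : E x s - E y s = Real.exp (l * s) * (x ⟨s, hs⟩ - y ⟨s, hs⟩) := by
        simp only [E, Set.IccExtend_of_mem hR _ hs]; ring
      rw [h2, abs_mul, abs_of_pos (Real.exp_pos _), mul_comm]
      gcongr
      rw [← Real.dist_eq]
      exact ContinuousMap.dist_apply_le_dist (f := x) (g := y) ⟨s, hs⟩
    have h3 := hT _ _ (hE x) (hE y) l hl1 _ dist_nonneg h1 t t.2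
    have h4 : Φ x t - Φ y t = Real.exp (-(l * (t : ℝ))) * (T (E x) t - T (E y) t) := by
      simp only [Φ, ContinuousMap.coe_mk]; ring
    rw [Real.dist_eq, h4, abs_mul, abs_of_pos (Real.exp_pos _)]
    calc _ ≤ Real.exp (-(l * (t : ℝ))) * (K / l * dist x y * Real.exp (l * t)) := by gcongr
      _ = K / l * dist x y := by
          rw [Real.exp_neg]; field_simp
      _ ≤ ((1 / 2 : NNReal) : ℝ) * dist x y := by
          push_cast; gcongr
  have hfix : Φ (hΦ.fixedPoint Φ) = hΦ.fixedPoint Φ := hΦ.fixedPoint_isFixedPt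
  set x := hΦ.fixedPoint Φ
  refine ⟨E x, hE x, fun t ht => ?_⟩
  have h5 : Real.exp (-(l * t)) * T (E x) t = x ⟨t, ht⟩ := congrArg (fun y => y ⟨t, ht⟩) hfix
  simp only [E, Set.IccExtend_of_mem hR _ ht, ← h5]
  rw [Real.exp_neg, mul_inv_cancel_left₀ (Real.exp_pos _).ne']

/-- Fixed points of two operators that differ by at most `ε` differ by at most a multiple of `ε`;
for `ε = 0` this is uniqueness of the fixed point. -/
theorem VolterraBound.dist_fixedPoint_le {R K ε : ℝ} {T T' : (ℝ → ℝ) → ℝ → ℝ} (hR : 0 ≤ R)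
    (hK : 0 ≤ K) (hT : VolterraBound R K T) {p q : ℝ → ℝ} (hp : Continuous p) (hq : Continuous q)
    (hε : 0 ≤ ε) (hTT' : ∀ t ∈ Set.Icc 0 R, |T q t - T' q t| ≤ ε)
    (hpT : ∀ t ∈ Set.Icc 0 R, T p t = p t) (hqT : ∀ t ∈ Set.Icc 0 R, T' q t = q t) :
    ∀ t ∈ Set.Icc 0 R, |p t - q t| ≤ 2 * Real.exp ((2 * K + 1) * R) * ε := by
  set l : ℝ := 2 * K + 1 with hl
  have hl1 : 1 ≤ l := by linarith
  have hKl : K / l ≤ 1 / 2 := by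
    rw [div_le_div_iff₀ (by linarith) (by norm_num)]; linarith
  obtain ⟨r, hr, hmax⟩ := isCompact_Icc.exists_isMaxOn (Set.nonempty_Icc.2 hR)
    (by fun_prop : ContinuousOn (fun t => |p t - q t| * Real.exp (-(l * t))) (Set.Icc 0 R))
  set D := |p r - q r| * Real.exp (-(l * r)) with hD
  have hD0 : 0 ≤ D := by positivity
  have hb : ∀ t ∈ Set.Icc 0 R, |p t - q t| ≤ D * Real.exp (l * t) := by
    intro t ht
    have h1 : |p t - q t| * Real.exp (-(l * t)) ≤ D := hmax ht
    calc |p t - q t| = |p t - q t| * Real.exp (-(l * t)) * Real.exp (l * t) := by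
          rw [mul_assoc, ← Real.exp_add]; simp
      _ ≤ _ := by gcongr
  have h2 : |p r - q r| ≤ K / l * D * Real.exp (l * r) + ε := by
    have h3 := hT p q hp hq l hl1 D hD0 hb r hr
    have h4 := hTT' r hr
    rw [hpT r hr] at h3
    rw [hqT r hr] at h4
    calc |p r - q r| ≤ |p r - T q r| + |T q r - q r| := abs_sub_le _ _ _
      _ ≤ _ := add_le_add h3 h4
  have hr0 : 0 ≤ l * r := mul_nonneg (by linarith) hr.1
  have h5 : D ≤ 1 / 2 * D + ε := by
    calc D ≤ (K / l * D * Real.exp (l * r) + ε) * Real.exp (-(l * r)) := by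
          rw [hD]; gcongr
      _ = K / l * D + ε * Real.exp (-(l * r)) := by
          rw [add_mul, mul_assoc (K / l * D), ← Real.exp_add]; simp
      _ ≤ 1 / 2 * D + ε * 1 := by
          gcongr
          exact Real.exp_le_one_iff.2 (by linarith)
      _ = _ := by ring
  intro t ht
  calc |p t - q t| ≤ D * Real.exp (l * t) := hb t ht
    _ ≤ (2 * ε) * Real.exp (l * R) := by
        gcongr
        · linarith
        · exact ht.2
    _ = _ := by ring

/-! ### The truncated profile equation -/

/-- Truncation of a sine to `[-√3/2, √3/2]`, that is, of the angle to `[-60°, 60°]`. -/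
noncomputable def clipSin (x : ℝ) : ℝ := max (-(√3 / 2)) (min x (√3 / 2))

/-- The cosine of the truncated angle. -/
noncomputable def clipCos (x : ℝ) : ℝ := √(1 - clipSin x ^ 2)

/-- The slope (tangent) of the truncated angle. -/
noncomputable def clipTan (x : ℝ) : ℝ := clipSin x / clipCos x

theorem sqrt_three_lt : √3 < 1.8 := by
  rw [Real.sqrt_lt' (by norm_num)]; norm_num

theorem lt_sqrt_three : 1.7 < √3 := by
  rw [Real.lt_sqrt (by norm_num)]; norm_num

theorem abs_clipSin_le (x : ℝ) : |clipSin x| ≤ √3 / 2 := by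
  have := Real.sqrt_nonneg 3
  unfold clipSin
  rw [abs_le]
  exact ⟨le_max_left _ _, max_le (by linarith) (min_le_right _ _)⟩

theorem clipSin_mono : Monotone clipSin := fun _ _ h =>
  max_le_max le_rfl (min_le_min h le_rfl)

theorem clipSin_of_abs_le {x : ℝ} (h : |x| ≤ √3 / 2) : clipSin x = x := by
  rw [abs_le] at h
  unfold clipSin
  rw [min_eq_left h.2, max_eq_right h.1]

theorem clipSin_zero : clipSin 0 = 0 :=
  clipSin_of_abs_le (by rw [abs_zero]; positivity)

theorem le_clipSin {x : ℝ} (h : x ≤ 0) : x ≤ clipSin x := by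
  have := Real.sqrt_nonneg 3
  unfold clipSin
  rw [min_eq_left (by linarith)]
  exact le_max_right _ _

theorem abs_clipSin_sub_le (x y : ℝ) : |clipSin x - clipSin y| ≤ |x - y| := by
  unfold clipSin
  calc _ ≤ |min x (√3 / 2) - min y (√3 / 2)| := by
        simpa using abs_max_sub_max_le_max (-(√3 / 2)) (min x (√3 / 2)) (-(√3 / 2)) (min y (√3 / 2))
    _ ≤ _ := by
        simpa using abs_min_sub_min_le_max x (√3 / 2) y (√3 / 2)

theorem clipSin_sq_le (x : ℝ) : clipSin x ^ 2 ≤ 3 / 4 := by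
  have h := abs_clipSin_le x
  have h2 := sq_le_sq' (by linarith [neg_abs_le (clipSin x)]) ((le_abs_self _).trans h)
  rw [div_pow, Real.sq_sqrt (by norm_num)] at h2
  linarith

theorem clipCos_sq (x : ℝ) : clipCos x ^ 2 = 1 - clipSin x ^ 2 :=
  Real.sq_sqrt (by linarith [clipSin_sq_le x])

theorem half_le_clipCos (x : ℝ) : 1 / 2 ≤ clipCos x :=
  Real.le_sqrt_of_sq_le (by linarith [clipSin_sq_le x])

theorem clipCos_pos (x : ℝ) : 0 < clipCos x := by linarith [half_le_clipCos x]

theorem clipCos_le_one (x : ℝ) : clipCos x ≤ 1 :=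
  Real.sqrt_le_one.2 (by linarith [sq_nonneg (clipSin x)])

theorem abs_clipCos_sub_le (x y : ℝ) : |clipCos x - clipCos y| ≤ 2 * |x - y| := by
  have hx := half_le_clipCos x
  have hy := half_le_clipCos y
  have h1 : (clipCos x - clipCos y) * (clipCos x + clipCos y)
      = -((clipSin x - clipSin y) * (clipSin x + clipSin y)) := by
    linear_combination clipCos_sq x - clipCos_sq y
  have h2 : |clipCos x - clipCos y| * (clipCos x + clipCos y)
      = |clipSin x - clipSin y| * |clipSin x + clipSin y| := by
    rw [← abs_of_pos (by linarith : 0 < clipCos x + clipCos y), ← abs_mul, h1, abs_neg, abs_mul]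
  have h3 : |clipSin x + clipSin y| ≤ 2 := by
    have := abs_add_le (clipSin x) (clipSin y)
    linarith [abs_clipSin_le x, abs_clipSin_le y, sqrt_three_lt]
  calc |clipCos x - clipCos y| ≤ |clipCos x - clipCos y| * (clipCos x + clipCos y) :=
        le_mul_of_one_le_right (abs_nonneg _) (by linarith)
    _ = |clipSin x - clipSin y| * |clipSin x + clipSin y| := h2
    _ ≤ |x - y| * 2 :=
        mul_le_mul (abs_clipSin_sub_le x y) h3 (abs_nonneg _) (abs_nonneg _)
    _ = _ := by ring

theorem clipCos_zero : clipCos 0 = 1 := by simp [clipCos, clipSin_zero]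

theorem clipTan_mul_clipCos (x : ℝ) : clipTan x * clipCos x = clipSin x :=
  div_mul_cancel₀ _ (clipCos_pos x).ne'

theorem abs_clipTan_le (x : ℝ) : |clipTan x| ≤ 2 := by
  unfold clipTan
  rw [abs_div, abs_of_pos (clipCos_pos x), div_le_iff₀ (clipCos_pos x)]
  linarith [abs_clipSin_le x, half_le_clipCos x, sqrt_three_lt]

theorem abs_clipTan_sub_le (x y : ℝ) : |clipTan x - clipTan y| ≤ 12 * |x - y| := by
  have hx := half_le_clipCos x
  have h1 : (clipTan x - clipTan y) * clipCos x
      = (clipSin x - clipSin y) - clipTan y * (clipCos x - clipCos y) := by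
    linear_combination clipTan_mul_clipCos x - clipTan_mul_clipCos y
  have h2 : |clipTan x - clipTan y| * clipCos x
      = |(clipSin x - clipSin y) - clipTan y * (clipCos x - clipCos y)| := by
    rw [← h1, abs_mul, abs_of_pos (clipCos_pos x)]
  have h3 : |clipTan y * (clipCos x - clipCos y)| ≤ 2 * (2 * |x - y|) := by
    rw [abs_mul]
    exact mul_le_mul (abs_clipTan_le y) (abs_clipCos_sub_le x y) (abs_nonneg _) (by norm_num)
  have h4 := abs_sub (clipSin x - clipSin y) (clipTan y * (clipCos x - clipCos y))
  have h5 := abs_clipSin_sub_le x y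
  have h6 : |clipTan x - clipTan y| * (1 / 2) ≤ |clipTan x - clipTan y| * clipCos x := by gcongr
  linarith [abs_nonneg (x - y)]

theorem continuous_clipSin : Continuous clipSin := by
  unfold clipSin; fun_prop

theorem continuous_clipCos : Continuous clipCos := by
  have := continuous_clipSin
  unfold clipCos; fun_prop

theorem continuous_clipTan : Continuous clipTan :=
  continuous_clipSin.div continuous_clipCos fun x => (clipCos_pos x).ne'

theorem clipTan_mono : Monotone clipTan := by
  intro x y h
  have hs := clipSin_mono h
  have hx := clipCos_pos x
  have hy := clipCos_pos y
  unfold clipTan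
  rw [div_le_div_iff₀ hx hy]
  by_contra! hlt
  -- the squares of both sides compare like the sines, whichever the signs of the latter
  have hX := clipCos_sq x
  have hY := clipCos_sq y
  rcases le_or_gt 0 (clipSin x) with h0 | h0
  · have : clipCos y ≤ clipCos x := by
      apply Real.sqrt_le_sqrt; nlinarith
    nlinarith [mul_le_mul hs this hy.le (h0.trans hs)]
  · rcases le_or_gt (clipSin y) 0 with h1 | h1
    · have : clipCos x ≤ clipCos y := by
        apply Real.sqrt_le_sqrt; nlinarith
      nlinarith [mul_le_mul_of_nonneg_left this (neg_nonneg.2 h1),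
        mul_le_mul_of_nonneg_right hs hy.le]
    · nlinarith [mul_pos h1 hx, mul_pos (neg_pos.2 h0) hy]

/-- The height of the graph with initial height `a` whose angle has sine `q`. -/
noncomputable def height (a : ℝ) (q : ℝ → ℝ) (t : ℝ) : ℝ := a + ∫ s in (0 : ℝ)..t, clipTan (q s)

/-- The right-hand side of `(t q)' = t * forcing`, the profile equation in divergence form. -/
noncomputable def forcing (a : ℝ) (q : ℝ → ℝ) (t : ℝ) : ℝ :=
  t * q t - height a q t * clipCos (q t)

/-- The weighted mean `u⁻² ∫₀ᵘ t h(t) dt`, written without a singularity at `u = 0`. -/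
noncomputable def weightedMean (h : ℝ → ℝ) (u : ℝ) : ℝ := ∫ τ in (0 : ℝ)..1, τ * h (u * τ)

/-- The integral operator whose fixed points are the sines of the angle along the profiles of
initial height `a`, as functions of the distance to the axis. -/
noncomputable def profileOp (a : ℝ) (q : ℝ → ℝ) (u : ℝ) : ℝ := u * weightedMean (forcing a q) u

theorem hasDerivAt_height (a : ℝ) {q : ℝ → ℝ} (hq : Continuous q) (t : ℝ) :
    HasDerivAt (height a q) (clipTan (q t)) t :=
  ((continuous_clipTan.comp hq).integral_hasStrictDerivAt 0 t).hasDerivAt.const_add a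

theorem continuous_height (a : ℝ) {q : ℝ → ℝ} (hq : Continuous q) : Continuous (height a q) :=
  continuous_iff_continuousAt.2 fun t => (hasDerivAt_height a hq t).continuousAt

theorem continuous_forcing (a : ℝ) {q : ℝ → ℝ} (hq : Continuous q) : Continuous (forcing a q) :=
  (continuous_id.mul hq).sub ((continuous_height a hq).mul (continuous_clipCos.comp hq))

theorem continuous_weightedMean {h : ℝ → ℝ} (hh : Continuous h) :
    Continuous (weightedMean h) := by
  unfold weightedMean
  exact intervalIntegral.continuous_parametric_intervalIntegral_of_continuous' (by fun_prop) 0 1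

theorem continuous_profileOp (a : ℝ) {q : ℝ → ℝ} (hq : Continuous q) :
    Continuous (profileOp a q) :=
  continuous_id.mul (continuous_weightedMean (continuous_forcing a hq))

theorem weightedMean_zero (h : ℝ → ℝ) : weightedMean h 0 = h 0 / 2 := by
  simp [weightedMean]
  ring

theorem sq_mul_weightedMean (h : ℝ → ℝ) (u : ℝ) :
    u ^ 2 * weightedMean h u = ∫ t in (0 : ℝ)..u, t * h t := by
  have h1 := intervalIntegral.mul_integral_comp_mul_left (a := 0) (b := 1)
    (f := fun t : ℝ => t * h t) u
  rw [mul_zero, mul_one] at h1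
  rw [← h1, weightedMean, sq, mul_assoc, ← intervalIntegral.integral_const_mul]
  congr 2
  ext τ
  ring

/-- The fixed point equation is differentiated here; at `u = 0` the derivative exists because the
weighted mean is continuous there, with value `h 0 / 2`. -/
theorem hasDerivAt_mul_weightedMean {h : ℝ → ℝ} (hh : Continuous h) (u : ℝ) :
    HasDerivAt (fun u => u * weightedMean h u) (h u - weightedMean h u) u := by
  rcases eq_or_ne u 0 with rfl | hu
  · rw [weightedMean_zero, sub_half, ← weightedMean_zero, hasDerivAt_iff_tendsto_slope]
    refine ((continuous_weightedMean hh).tendsto 0).mono_left nhdsWithin_le_nhds |>.congr' ?_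
    filter_upwards [self_mem_nhdsWithin] with y hy
    rw [slope_def_field]
    have : y ≠ 0 := hy
    simp [this]
  · have h1 : HasDerivAt (fun u => (∫ t in (0 : ℝ)..u, t * h t) / u)
        (((u * h u) * u - (∫ t in (0 : ℝ)..u, t * h t) * 1) / u ^ 2) u :=
      ((continuous_id.mul hh).integral_hasStrictDerivAt 0 u).hasDerivAt.div (hasDerivAt_id u) hu
    have h2 : ((u * h u) * u - (∫ t in (0 : ℝ)..u, t * h t) * 1) / u ^ 2
        = h u - weightedMean h u := by
      rw [← sq_mul_weightedMean]; field_simp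
    rw [h2] at h1
    refine h1.congr_of_eventuallyEq ?_
    filter_upwards [isOpen_ne.mem_nhds hu] with y hy
    have : y ≠ 0 := hy
    rw [← sq_mul_weightedMean]; field_simp

theorem integral_exp_mul_le {l : ℝ} (hl : 0 < l) (u : ℝ) :
    ∫ t in (0 : ℝ)..u, Real.exp (l * t) ≤ Real.exp (l * u) / l := by
  have h := intervalIntegral.mul_integral_comp_mul_left (a := 0) (b := u)
    (f := fun t : ℝ => Real.exp t) l
  simp only [mul_zero, integral_exp, Real.exp_zero] at h
  rw [le_div_iff₀ hl, mul_comm, h]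
  linarith

theorem abs_height_sub_le (a : ℝ) {p q : ℝ → ℝ} (hp : Continuous p) (hq : Continuous q) {R l D : ℝ}
    (hl : 1 ≤ l) (hD : 0 ≤ D) (h : ∀ t ∈ Set.Icc 0 R, |p t - q t| ≤ D * Real.exp (l * t)) :
    ∀ t ∈ Set.Icc 0 R, |height a p t - height a q t| ≤ 12 * D * Real.exp (l * t) := by
  intro t ht
  have h1 : height a p t - height a q t = ∫ s in (0 : ℝ)..t, (clipTan (p s) - clipTan (q s)) := by
    have h2 := intervalIntegral.integral_sub
      ((continuous_clipTan.comp hp).intervalIntegrable (μ := MeasureTheory.volume) 0 t)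
      ((continuous_clipTan.comp hq).intervalIntegrable 0 t)
    simp only [Function.comp_apply] at h2
    rw [h2]
    unfold height; ring
  rw [h1, ← Real.norm_eq_abs]
  calc _ ≤ ∫ s in (0 : ℝ)..t, 12 * D * Real.exp (l * s) := by
        refine intervalIntegral.norm_integral_le_of_norm_le ht.1 (.of_forall fun s hs => ?_)
          (Continuous.intervalIntegrable (by fun_prop) _ _)
        have := h s ⟨hs.1.le, hs.2.trans ht.2⟩
        rw [Real.norm_eq_abs]
        linarith [abs_clipTan_sub_le (p s) (q s)]
    _ = 12 * D * ∫ s in (0 : ℝ)..t, Real.exp (l * s) := intervalIntegral.integral_const_mul _ _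
    _ ≤ 12 * D * (Real.exp (l * t) / l) := by
        gcongr
        exact integral_exp_mul_le (by linarith) t
    _ ≤ _ := by
        gcongr
        exact div_le_self (Real.exp_pos _).le hl

theorem abs_height_le {a : ℝ} (q : ℝ → ℝ) {t : ℝ} (ht : 0 ≤ t) :
    |height a q t| ≤ |a| + 2 * t := by
  have h1 : ‖∫ s in (0 : ℝ)..t, clipTan (q s)‖ ≤ 2 * |t - 0| :=
    intervalIntegral.norm_integral_le_of_norm_le_const fun s _ => abs_clipTan_le (q s)
  rw [Real.norm_eq_abs] at h1
  rw [sub_zero, abs_of_nonneg ht] at h1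
  exact (abs_add_le _ _).trans (by linarith)

theorem abs_mul_weightedMean_sub_le {h k : ℝ → ℝ} (hh : Continuous h) (hk : Continuous k)
    {g : ℝ → ℝ} (hg : Continuous g) {u : ℝ} (hu : 0 ≤ u)
    (hb : ∀ t ∈ Set.Icc 0 u, |h t - k t| ≤ g t) :
    |u * weightedMean h u - u * weightedMean k u| ≤ ∫ t in (0 : ℝ)..u, g t := by
  have h1 : weightedMean h u - weightedMean k u
      = ∫ τ in (0 : ℝ)..1, τ * (h (u * τ) - k (u * τ)) := by
    unfold weightedMean
    have c1 : Continuous fun τ : ℝ => τ * h (u * τ) := by fun_prop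
    have c2 : Continuous fun τ : ℝ => τ * k (u * τ) := by fun_prop
    rw [← intervalIntegral.integral_sub (c1.intervalIntegrable _ _) (c2.intervalIntegrable _ _)]
    congr 1
    ext τ
    ring
  have h2 := intervalIntegral.mul_integral_comp_mul_left (a := 0) (b := 1) (f := g) u
  rw [mul_zero, mul_one] at h2
  rw [← h2, ← mul_sub, abs_mul, abs_of_nonneg hu, h1]
  gcongr
  have c3 : Continuous fun τ : ℝ => g (u * τ) := by fun_prop
  rw [← Real.norm_eq_abs]
  refine intervalIntegral.norm_integral_le_of_norm_le zero_le_one (.of_forall fun τ hτ => ?_)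
    (c3.intervalIntegrable _ _)
  rw [Real.norm_eq_abs, abs_mul, abs_of_pos hτ.1]
  calc τ * |h (u * τ) - k (u * τ)| ≤ 1 * |h (u * τ) - k (u * τ)| := by
        gcongr; exact hτ.2
    _ ≤ _ := by
        rw [one_mul]
        exact hb _ ⟨mul_nonneg hu hτ.1.le, mul_le_of_le_one_right hu hτ.2⟩

theorem volterraBound_profileOp {a : ℝ} (ha : a ∈ Set.Icc (0 : ℝ) 6) :
    VolterraBound 10 74 (profileOp a) := by
  intro p q hp hq l hl D hD h u hu
  have key : ∀ t ∈ Set.Icc 0 u, |forcing a p t - forcing a q t| ≤ 74 * D * Real.exp (l * t) := by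
    intro t ht
    have ht' : t ∈ Set.Icc (0 : ℝ) 10 := ⟨ht.1, ht.2.trans hu.2⟩
    have h0 := h t ht'
    have h1 := abs_height_sub_le a hp hq hl hD h t ht'
    have h2 : |height a q t| ≤ 26 := by
      have := abs_height_le (a := a) q ht.1
      rw [abs_of_nonneg ha.1] at this
      linarith [ha.2, ht'.2]
    have h3 := abs_clipCos_sub_le (p t) (q t)
    have e : forcing a p t - forcing a q t = t * (p t - q t)
        - ((height a p t - height a q t) * clipCos (p t)
          + height a q t * (clipCos (p t) - clipCos (q t))) := by
      unfold forcing; ring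
    have b1 : |t * (p t - q t)| ≤ 10 * (D * Real.exp (l * t)) := by
      rw [abs_mul, abs_of_nonneg ht.1]
      exact mul_le_mul ht'.2 h0 (abs_nonneg _) (by norm_num)
    have b2 : |(height a p t - height a q t) * clipCos (p t)| ≤ 12 * D * Real.exp (l * t) * 1 := by
      rw [abs_mul, abs_of_pos (clipCos_pos _)]
      exact mul_le_mul h1 (clipCos_le_one _) (clipCos_pos _).le (by positivity)
    have b3 : |height a q t * (clipCos (p t) - clipCos (q t))| ≤ 26 * (2 * |p t - q t|) := by
      rw [abs_mul]
      exact mul_le_mul h2 h3 (abs_nonneg _) (by norm_num)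
    rw [e]
    have c1 := abs_sub (t * (p t - q t)) ((height a p t - height a q t) * clipCos (p t)
          + height a q t * (clipCos (p t) - clipCos (q t)))
    have c2 := abs_add_le ((height a p t - height a q t) * clipCos (p t))
      (height a q t * (clipCos (p t) - clipCos (q t)))
    linarith
  calc _ ≤ ∫ t in (0 : ℝ)..u, 74 * D * Real.exp (l * t) :=
        abs_mul_weightedMean_sub_le (continuous_forcing a hp) (continuous_forcing a hq)
          (by fun_prop) hu.1 key
    _ = 74 * D * ∫ t in (0 : ℝ)..u, Real.exp (l * t) := intervalIntegral.integral_const_mul _ _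
    _ ≤ 74 * D * (Real.exp (l * u) / l) := by
        gcongr
        exact integral_exp_mul_le (by linarith) u
    _ = _ := by ring

theorem abs_profileOp_sub_le (a b : ℝ) {q : ℝ → ℝ} (hq : Continuous q) {u : ℝ}
    (hu : u ∈ Set.Icc (0 : ℝ) 10) : |profileOp a q u - profileOp b q u| ≤ 10 * |a - b| := by
  have h := abs_mul_weightedMean_sub_le (continuous_forcing a hq) (continuous_forcing b hq)
    (continuous_const (y := |a - b|)) hu.1 fun t _ => by
      have e : forcing a q t - forcing b q t = -((a - b) * clipCos (q t)) := by
        unfold forcing height; ring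
      rw [e, abs_neg, abs_mul, abs_of_pos (clipCos_pos _)]
      exact mul_le_of_le_one_right (abs_nonneg _) (clipCos_le_one _)
  refine h.trans ?_
  rw [intervalIntegral.integral_const, smul_eq_mul, sub_zero]
  gcongr
  exact hu.2

/-- `q` (the sine of the angle) and `f` (the height), as functions of the distance `u ∈ [0, 10]` to
the axis, are the truncated profile of initial height `a`; `m` is the function `q u / u`, extended
continuously to `u = 0`. -/
structure IsClippedProfile (a : ℝ) (q f m : ℝ → ℝ) : Prop where
  continuous_sin : Continuous q
  continuous_height : Continuous f
  continuous_mean : Continuous m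
  height_zero : f 0 = a
  sin_eq : ∀ u, q u = u * m u
  mean_zero : m 0 = -(a / 2)
  hasDerivAt_height : ∀ u ∈ Set.Icc (0 : ℝ) 10, HasDerivAt f (clipTan (q u)) u
  hasDerivAt_sin : ∀ u ∈ Set.Icc (0 : ℝ) 10,
    HasDerivAt q (u * q u - f u * clipCos (q u) - m u) u

theorem exists_clippedProfile_family : ∃ q f m : ℝ → ℝ → ℝ,
    (∀ a ∈ Set.Icc (0 : ℝ) 6, IsClippedProfile a (q a) (f a) (m a)) ∧
    (∀ u ∈ Set.Icc (0 : ℝ) 10, ContinuousOn (fun a => q a u) (Set.Icc 0 6) ∧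
      ContinuousOn (fun a => f a u) (Set.Icc 0 6) ∧ q 0 u = 0) := by
  have hex : ∀ a : ℝ, ∃ q : ℝ → ℝ, a ∈ Set.Icc (0 : ℝ) 6 →
      Continuous q ∧ ∀ t ∈ Set.Icc (0 : ℝ) 10, profileOp a q t = q t := by
    intro a
    by_cases ha : a ∈ Set.Icc (0 : ℝ) 6
    · obtain ⟨q, hq⟩ := (volterraBound_profileOp ha).exists_fixedPoint (by norm_num) (by norm_num)
        fun q hq => continuous_profileOp a hq
      exact ⟨q, fun _ => hq⟩
    · exact ⟨0, fun h => absurd h ha⟩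
  choose p hp using hex
  have hlip : ∃ C : ℝ, 0 ≤ C ∧ ∀ a ∈ Set.Icc (0 : ℝ) 6, ∀ b ∈ Set.Icc (0 : ℝ) 6,
      ∀ t ∈ Set.Icc (0 : ℝ) 10, |p a t - p b t| ≤ C * |a - b| := by
    refine ⟨2 * Real.exp ((2 * 74 + 1) * 10) * 10, by positivity, fun a ha b hb t ht => ?_⟩
    rw [mul_assoc _ (10 : ℝ)]
    exact (volterraBound_profileOp ha).dist_fixedPoint_le (by norm_num) (by norm_num)
      (hp a ha).1 (hp b hb).1 (by positivity)
      (fun s hs => abs_profileOp_sub_le a b (hp b hb).1 hs) (hp a ha).2 (hp b hb).2 t ht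
  obtain ⟨C, hC, hlip⟩ := hlip
  have hheight : ∀ a ∈ Set.Icc (0 : ℝ) 6, ∀ b ∈ Set.Icc (0 : ℝ) 6,
      ∀ t ∈ Set.Icc (0 : ℝ) 10, |height a (p a) t - height b (p b) t|
        ≤ (1 + 12 * C * Real.exp 10) * |a - b| := by
    intro a ha b hb t ht
    have h1 := abs_height_sub_le a (hp a ha).1 (hp b hb).1 (R := 10) (l := 1) (D := C * |a - b|)
      le_rfl (by positivity) (fun s hs => (hlip a ha b hb s hs).trans
        (le_mul_of_one_le_right (by positivity) (Real.one_le_exp (by linarith [hs.1])))) t ht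
    have h2 : height a (p a) t - height b (p b) t
        = (height a (p a) t - height a (p b) t) + (a - b) := by
      unfold height; ring
    have h3 : Real.exp (1 * t) ≤ Real.exp 10 := Real.exp_le_exp.2 (by linarith [ht.2])
    rw [h2]
    calc _ ≤ |height a (p a) t - height a (p b) t| + |a - b| := abs_add_le _ _
      _ ≤ 12 * (C * |a - b|) * Real.exp 10 + |a - b| := by
          gcongr
          exact h1.trans (by gcongr)
      _ = _ := by ring
  have hcont : ∀ (F : ℝ → ℝ) (C : ℝ), 0 ≤ C → (∀ a ∈ Set.Icc (0 : ℝ) 6, ∀ b ∈ Set.Icc (0 : ℝ) 6,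
      |F a - F b| ≤ C * |a - b|) → ContinuousOn F (Set.Icc 0 6) := fun F C hC hF =>
    (LipschitzOnWith.of_dist_le_mul (K := ⟨C, hC⟩) fun a ha b hb => hF a ha b hb).continuousOn
  -- off `[0, 10]` the fixed point equation need not hold; `profileOp a (p a)` is the extension of
  -- the fixed point that is differentiable at the end points, too
  refine ⟨fun a => profileOp a (p a), fun a => height a (p a),
    fun a => weightedMean (forcing a (p a)), fun a ha => ?_, fun u hu => ⟨?_, ?_, ?_⟩⟩
  · have hc := (hp a ha).1
    refine ⟨continuous_profileOp a hc, continuous_height a hc,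
      continuous_weightedMean (continuous_forcing a hc), by simp [height], fun u => rfl, ?_, ?_, ?_⟩
    · have h0 : p a 0 = 0 := by
        rw [← (hp a ha).2 0 ⟨le_rfl, by norm_num⟩]; simp [profileOp]
      change weightedMean _ 0 = _
      rw [weightedMean_zero]
      simp [forcing, height, h0, clipCos_zero]
      ring
    · intro u hu
      beta_reduce
      rw [(hp a ha).2 u hu]
      exact hasDerivAt_height a hc u
    · intro u hu
      have h := hasDerivAt_mul_weightedMean (continuous_forcing a hc) u
      beta_reduce
      rw [(hp a ha).2 u hu]
      exact h
  · refine hcont _ C hC fun a ha b hb => ?_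
    beta_reduce
    rw [(hp a ha).2 u hu, (hp b hb).2 u hu]
    exact hlip a ha b hb u hu
  · exact hcont _ _ (by positivity) fun a ha b hb => hheight a ha b hb u hu
  · have h0 : (0 : ℝ) ∈ Set.Icc (0 : ℝ) 6 := ⟨le_rfl, by norm_num⟩
    have hz : ∀ t ∈ Set.Icc (0 : ℝ) 10, profileOp 0 (fun _ => 0) t = (fun _ => (0 : ℝ)) t := by
      intro t _
      simp [profileOp, weightedMean, forcing, height, clipTan, clipSin_zero]
    have := (volterraBound_profileOp h0).dist_fixedPoint_le (ε := 0) (T' := profileOp 0)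
      (by norm_num) (by norm_num)
      (hp 0 h0).1 (continuous_const (y := (0 : ℝ))) le_rfl (by simp) (hp 0 h0).2 hz u hu
    rw [mul_zero, abs_nonpos_iff, sub_zero] at this
    beta_reduce
    rw [(hp 0 h0).2 u hu, this]

/-! ### Convexity of the profiles -/

theorem HasDerivAt.clipCos_comp_of_zero {q : ℝ → ℝ} {x : ℝ} (h : HasDerivAt q 0 x) :
    HasDerivAt (fun u => clipCos (q u)) 0 x := by
  rw [hasDerivAt_iff_isLittleO] at h ⊢
  simp only [smul_zero, sub_zero] at h ⊢
  exact (Asymptotics.IsBigO.of_bound 2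
    (.of_forall fun u => abs_clipCos_sub_le (q u) (q x))).trans_isLittleO h

namespace IsClippedProfile

variable {a : ℝ} {q f m : ℝ → ℝ}

theorem sin_zero (h : IsClippedProfile a q f m) : q 0 = 0 := by
  rw [h.sin_eq, zero_mul]

theorem strictAntiOn_sin_of_neg (h : IsClippedProfile a q f m) {r : ℝ} (hr : r ≤ 10)
    (hk : ∀ u ∈ Set.Ioo 0 r, u * q u - f u * clipCos (q u) - m u < 0) :
    StrictAntiOn q (Set.Icc 0 r) := by
  refine strictAntiOn_of_deriv_neg (convex_Icc 0 r) h.continuous_sin.continuousOn fun u hu => ?_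
  rw [interior_Icc] at hu
  rw [(h.hasDerivAt_sin u ⟨hu.1.le, hu.2.le.trans hr⟩).deriv]
  exact hk u hu

/-- The angle is strictly decreasing. At a first zero `r` of `k = q'`, the truncated cosine is
stationary, as `q` is, so that `k' = q - clipSin q + q / r²` there; this is negative, whereas `k`
reaches `0` from below. -/
theorem deriv_sin_neg (h : IsClippedProfile a q f m) (ha : 0 < a) :
    ∀ u ∈ Set.Icc (0 : ℝ) 10, u * q u - f u * clipCos (q u) - m u < 0 := by
  set k : ℝ → ℝ := fun u => u * q u - f u * clipCos (q u) - m u with hk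
  have hkc : Continuous k := ((continuous_id.mul h.continuous_sin).sub
    (h.continuous_height.mul (continuous_clipCos.comp h.continuous_sin))).sub h.continuous_mean
  have hk0 : k 0 < 0 := by
    simp only [hk, h.sin_zero, h.height_zero, h.mean_zero, clipCos_zero]
    linarith
  by_contra! hcon
  obtain ⟨w, hw, hkw⟩ := hcon
  have hcomp : IsCompact (Set.Icc (0 : ℝ) 10 ∩ {u | 0 ≤ k u}) :=
    isCompact_Icc.inter_right (isClosed_le continuous_const hkc)
  obtain ⟨r, ⟨hr, hkr : 0 ≤ k r⟩, hleast⟩ := hcomp.exists_isLeast ⟨w, hw, hkw⟩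
  have hr0 : 0 < r := by
    rcases hr.1.eq_or_lt with h0 | h0
    · rw [← h0] at hkr; linarith
    · exact h0
  have hneg : ∀ u, 0 ≤ u → u < r → k u < 0 := by
    intro u hu hur
    by_contra! hku
    exact absurd (hleast ⟨⟨hu, hur.le.trans hr.2⟩, hku⟩) (not_le.2 hur)
  have hleft : ∀ᶠ u in nhdsWithin r (Set.Iio r), k u < 0 ∧ u < r := by
    filter_upwards [Ioo_mem_nhdsLT hr0] with u hu
    exact ⟨hneg u hu.1.le hu.2, hu.2⟩
  have hkr0 : k r = 0 := le_antisymm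
    (le_of_tendsto ((hkc.tendsto r).mono_left nhdsWithin_le_nhds)
      (hleft.mono fun u hu => hu.1.le)) hkr
  have hqr : q r < 0 := by
    have := h.strictAntiOn_sin_of_neg hr.2 (fun u hu => hneg u hu.1.le hu.2)
      ⟨le_rfl, hr.1⟩ ⟨hr.1, le_rfl⟩ hr0
    rwa [h.sin_zero] at this
  have hdq : HasDerivAt q 0 r := by
    rw [← hkr0]; exact h.hasDerivAt_sin r hr
  have hdm : HasDerivAt m ((0 * r - q r * 1) / r ^ 2) r := by
    refine (hdq.div (hasDerivAt_id r) hr0.ne').congr_of_eventuallyEq ?_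
    filter_upwards [isOpen_ne.mem_nhds hr0.ne'] with u hu
    have : u ≠ 0 := hu
    simp only [Pi.div_apply, id, h.sin_eq u]
    field_simp
  have hdk := (((hasDerivAt_id r).mul hdq).sub
    ((h.hasDerivAt_height r hr).mul hdq.clipCos_comp_of_zero)).sub hdm
  have hval : 1 * q r + id r * 0 - (clipTan (q r) * clipCos (q r) + f r * 0)
      - (0 * r - q r * 1) / r ^ 2 < 0 := by
    rw [clipTan_mul_clipCos]
    have h1 := le_clipSin hqr.le
    have h2 : q r / r ^ 2 < 0 := div_neg_of_neg_of_pos hqr (by positivity)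
    have h3 : (0 * r - q r * 1) / r ^ 2 = -(q r / r ^ 2) := by ring
    rw [h3]
    linarith
  have hslope := (hasDerivAt_iff_tendsto_slope.1 hdk).mono_left
    (show nhdsWithin r (Set.Iio r) ≤ _ from
      nhdsWithin_mono r fun u hu => (Set.mem_Iio.1 hu).ne)
  refine absurd (ge_of_tendsto hslope ?_) (not_le.2 hval)
  filter_upwards [hleft] with u hu
  have h1 : slope k r u = k u / (u - r) := by rw [slope_def_field, hkr0, sub_zero]
  exact h1.symm ▸ (div_pos_of_neg_of_neg hu.1 (by linarith [hu.2])).le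

theorem strictAntiOn_sin (h : IsClippedProfile a q f m) (ha : 0 < a) :
    StrictAntiOn q (Set.Icc 0 10) :=
  h.strictAntiOn_sin_of_neg le_rfl fun u hu => h.deriv_sin_neg ha u ⟨hu.1.le, hu.2.le⟩

theorem sin_neg (h : IsClippedProfile a q f m) (ha : 0 < a) {u : ℝ} (hu : 0 < u) (hu' : u ≤ 10) :
    q u < 0 := by
  have := h.strictAntiOn_sin ha ⟨le_rfl, by norm_num⟩ ⟨hu.le, hu'⟩ hu
  rwa [h.sin_zero] at this

theorem strictAntiOn_height (h : IsClippedProfile a q f m) (ha : 0 < a) :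
    StrictAntiOn f (Set.Icc 0 10) := by
  refine strictAntiOn_of_deriv_neg (convex_Icc _ _) h.continuous_height.continuousOn
    fun u hu => ?_
  rw [interior_Icc] at hu
  rw [(h.hasDerivAt_height u ⟨hu.1.le, hu.2.le⟩).deriv]
  have hq := h.sin_neg ha hu.1 hu.2.le
  have hs : clipSin (q u) < 0 := max_lt (by linarith [lt_sqrt_three]) ((min_le_left _ _).trans_lt hq)
  exact div_neg_of_neg_of_pos hs (clipCos_pos _)

theorem exists_clipTan_eq_slope (h : IsClippedProfile a q f m) {r s : ℝ} (hr : 0 ≤ r) (hrs : r < s)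
    (hs : s ≤ 10) : ∃ u ∈ Set.Ioo r s, clipTan (q u) = (f s - f r) / (s - r) :=
  exists_hasDerivAt_eq_slope f (fun u => clipTan (q u)) hrs h.continuous_height.continuousOn
    fun u hu => h.hasDerivAt_height u ⟨hr.trans hu.1.le, hu.2.le.trans hs⟩

/-- A profile that stays high bends down: integrate `(u q)' = u (u q - f cos)`, where the cosine is
at least `1 / 2`. -/
theorem sin_le (h : IsClippedProfile a q f m) (ha : 0 < a) {b r : ℝ} (hb : 0 ≤ b) (hr : 0 < r)
    (hr' : r ≤ 10) (hf : ∀ u ∈ Set.Icc 0 r, b ≤ f u) : q r ≤ -(b * r / 4) := by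
  have hd : ∀ u ∈ Set.Ioo 0 r, HasDerivAt (fun u => u * q u + b / 4 * u ^ 2)
      (u * (u * q u - f u * clipCos (q u) + b / 2)) u := by
    intro u hu
    have h1 := ((hasDerivAt_id u).mul (h.hasDerivAt_sin u ⟨hu.1.le, hu.2.le.trans hr'⟩)).add
      (((hasDerivAt_id u).pow 2).const_mul (b / 4))
    refine h1.congr_deriv ?_
    simp only [id]
    linear_combination h.sin_eq u
  have hanti : AntitoneOn (fun u => u * q u + b / 4 * u ^ 2) (Set.Icc 0 r) := by
    have hc := h.continuous_sin
    refine antitoneOn_of_deriv_nonpos (convex_Icc _ _)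
      (by fun_prop : Continuous fun u => u * q u + b / 4 * u ^ 2).continuousOn
      (fun u hu => ?_) fun u hu => ?_
    · rw [interior_Icc] at hu
      exact (hd u hu).differentiableAt.differentiableWithinAt
    · rw [interior_Icc] at hu
      rw [(hd u hu).deriv]
      refine mul_nonpos_of_nonneg_of_nonpos hu.1.le ?_
      have h1 := mul_nonpos_of_nonneg_of_nonpos hu.1.le
        (h.sin_neg ha hu.1 (hu.2.le.trans hr')).le
      have h2 := hf u ⟨hu.1.le, hu.2.le⟩
      have h3 : b * (1 / 2) ≤ f u * clipCos (q u) :=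
        mul_le_mul h2 (half_le_clipCos _) (by norm_num) (hb.trans h2)
      linarith
  have h1 := hanti ⟨le_rfl, hr.le⟩ ⟨hr.le, le_rfl⟩ hr.le
  simp only [zero_mul] at h1
  have h2 : r * (q r + b * r / 4) ≤ 0 := by linarith
  have h3 := nonpos_of_mul_nonpos_right h2 hr
  linarith

theorem height_ten_neg (h : IsClippedProfile a q f m) (ha : 0 < a) (ha' : a ≤ 6) : f 10 < 0 := by
  obtain ⟨r, hr, hr'⟩ := h.exists_clipTan_eq_slope (r := 1) (s := 10) (by norm_num) (by norm_num)
    le_rfl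
  have hmono := h.strictAntiOn_sin ha
  rcases lt_or_ge (f 1) (a / 2) with h1 | h1
  · -- the mean slope over `[0, 1]` is below `-a / 2`, and the slope is decreasing
    obtain ⟨s, hs, hs'⟩ := h.exists_clipTan_eq_slope (r := 0) (s := 1) le_rfl (by norm_num)
      (by norm_num)
    have h2 : clipTan (q r) ≤ clipTan (q s) := clipTan_mono
      (hmono ⟨hs.1.le, by linarith [hs.2]⟩ ⟨by linarith [hr.1], hr.2.le⟩
        (by linarith [hs.2, hr.1])).le
    rw [hr', hs', h.height_zero, div_le_div_iff₀ (by norm_num) (by norm_num)] at h2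
    linarith
  · -- the sine of the angle at `u = 1` is at most `-a / 8`, and the slope is decreasing
    have hf := (h.strictAntiOn_height ha).antitoneOn
    have h2 : q 1 ≤ -(a / 2 * 1 / 4) := h.sin_le ha (by linarith) one_pos (by norm_num)
      fun u hu => h1.trans (hf ⟨hu.1, by linarith [hu.2]⟩ ⟨by norm_num, by norm_num⟩ hu.2)
    have h3 : q r ≤ -(a / 8) := by
      have := hmono ⟨by norm_num, by norm_num⟩ ⟨by linarith [hr.1], hr.2.le⟩ hr.1
      linarith
    have h4 : clipSin (-(a / 8)) = -(a / 8) := clipSin_of_abs_le (by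
      rw [abs_neg, abs_of_pos (by linarith)]; linarith [lt_sqrt_three])
    have h5 : clipTan (q r) ≤ -(a / 8) := by
      refine (clipTan_mono h3).trans ?_
      unfold clipTan
      rw [h4, div_le_iff₀ (clipCos_pos _)]
      nlinarith [clipCos_le_one (-(a / 8))]
    have h6 : f 1 ≤ a := by
      have := hf ⟨le_rfl, by norm_num⟩ ⟨by norm_num, by norm_num⟩ zero_le_one
      rwa [h.height_zero] at this
    rw [hr', div_le_iff₀ (by norm_num)] at h5
    linarith

end IsClippedProfile

/-! ### The shooting argument -/

/-- For some initial height the profile reaches the horizontal axis exactly when its angle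
reaches `-60°`. The initial heights for which the angle passes `-60°` at positive height, and those
for which the height is negative before the angle reaches `-60°`, form disjoint nonempty open sets,
which cannot cover `(0, 6]`. -/
theorem exists_clippedProfile_angle : ∃ (a z : ℝ) (q f m : ℝ → ℝ), 0 < a ∧
    IsClippedProfile a q f m ∧ z ∈ Set.Ioo (0 : ℝ) 10 ∧ f z = 0 ∧ q z = -(√3 / 2) := by
  obtain ⟨q, f, m, hprof, hcont⟩ := exists_clippedProfile_family
  have hproj : Continuous fun a : ℝ => max 0 (min a 6) := by fun_prop
  have hmem : ∀ a : ℝ, max 0 (min a 6) ∈ Set.Icc (0 : ℝ) 6 := fun a =>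
    ⟨le_max_left _ _, max_le (by norm_num) (min_le_right _ _)⟩
  have hid : ∀ a ∈ Set.Icc (0 : ℝ) 6, max 0 (min a 6) = a := fun a ha => by
    rw [min_eq_left ha.2, max_eq_right ha.1]
  -- the profiles are made constant in `a` outside `[0, 6]`, to be continuous in `a ∈ ℝ`
  obtain ⟨Q, hQ⟩ : ∃ Q : ℝ → ℝ → ℝ, ∀ a, Q a = q (max 0 (min a 6)) := ⟨_, fun _ => rfl⟩
  obtain ⟨F, hF⟩ : ∃ F : ℝ → ℝ → ℝ, ∀ a, F a = f (max 0 (min a 6)) := ⟨_, fun _ => rfl⟩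
  have hP : ∀ a ∈ Set.Icc (0 : ℝ) 6, IsClippedProfile a (Q a) (F a) (m a) := fun a ha => by
    rw [hQ, hF, hid a ha]; exact hprof a ha
  have hQc : ∀ u ∈ Set.Icc (0 : ℝ) 10, Continuous fun a => Q a u := fun u hu => by
    simp only [hQ]
    exact (hcont u hu).1.comp_continuous hproj hmem
  have hFc : ∀ u ∈ Set.Icc (0 : ℝ) 10, Continuous fun a => F a u := fun u hu => by
    simp only [hF]
    exact (hcont u hu).2.1.comp_continuous hproj hmem
  set A : Set ℝ := ⋃ u ∈ Set.Icc (0 : ℝ) 10, {a | 0 < F a u ∧ Q a u < -(√3 / 2)}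
  set B : Set ℝ := ⋃ u ∈ Set.Icc (0 : ℝ) 10, {a | F a u < 0 ∧ -(√3 / 2) < Q a u}
  have hAo : IsOpen A := isOpen_biUnion fun u hu =>
    (isOpen_lt continuous_const (hFc u hu)).inter (isOpen_lt (hQc u hu) continuous_const)
  have hBo : IsOpen B := isOpen_biUnion fun u hu =>
    (isOpen_lt (hFc u hu) continuous_const).inter (isOpen_lt continuous_const (hQc u hu))
  have hIcc : ∀ a ∈ Set.Ioc (0 : ℝ) 6, a ∈ Set.Icc (0 : ℝ) 6 := fun a ha => ⟨ha.1.le, ha.2⟩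
  have h10 : (10 : ℝ) ∈ Set.Icc (0 : ℝ) 10 := ⟨by norm_num, le_rfl⟩
  have hAne : (Set.Ioc (0 : ℝ) 6 ∩ A).Nonempty := by
    have h6 : (6 : ℝ) ∈ Set.Ioc (0 : ℝ) 6 := ⟨by norm_num, le_rfl⟩
    have hp := hP 6 (hIcc 6 h6)
    refine ⟨6, h6, Set.mem_biUnion (x := 3 / 2) ⟨by norm_num, by norm_num⟩ ?_⟩
    -- slopes are at least `-2`, so the height is at least `3` up to `u = 3 / 2`
    have hge : ∀ u ∈ Set.Icc (0 : ℝ) (3 / 2), 3 ≤ F 6 u := by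
      intro u hu
      rcases hu.1.eq_or_lt with h0 | h0
      · rw [← h0, hp.height_zero]; norm_num
      · obtain ⟨s, -, hs'⟩ := hp.exists_clipTan_eq_slope le_rfl h0 (by linarith [hu.2])
        have h1 := (abs_le.1 (abs_clipTan_le (Q 6 s))).1
        rw [hs', hp.height_zero, sub_zero, le_div_iff₀ h0] at h1
        linarith [hu.2]
    have h1 := hp.sin_le (by norm_num) (by norm_num) (by norm_num) (by norm_num) hge
    exact ⟨by linarith [hge (3 / 2) ⟨by norm_num, le_rfl⟩], by linarith [sqrt_three_lt]⟩
  have hBne : (Set.Ioc (0 : ℝ) 6 ∩ B).Nonempty := by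
    -- for small `a` the profile is close to the horizontal axis, the profile for `a = 0`
    have h0 : Q 0 10 = 0 := by
      rw [hQ, hid 0 ⟨le_rfl, by norm_num⟩]; exact (hcont 10 h10).2.2
    have h1 : ∀ᶠ a in nhds (0 : ℝ), -(√3 / 2) < Q a 10 :=
      (hQc 10 h10).continuousAt.eventually_const_lt (by beta_reduce; rw [h0]; linarith [lt_sqrt_three])
    obtain ⟨a, ha1, ha2⟩ := ((h1.filter_mono nhdsWithin_le_nhds).and
      (Ioo_mem_nhdsGT (by norm_num : (0 : ℝ) < 6))).exists
    have ha : a ∈ Set.Ioc (0 : ℝ) 6 := ⟨ha2.1, ha2.2.le⟩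
    exact ⟨a, ha, Set.mem_biUnion h10 ⟨(hP a (hIcc a ha)).height_ten_neg ha.1 ha.2, ha1⟩⟩
  have hdisj : ¬ (Set.Ioc (0 : ℝ) 6 ∩ (A ∩ B)).Nonempty := by
    rintro ⟨a, ha, haA, haB⟩
    obtain ⟨u, hu, hu1, hu2⟩ := Set.mem_iUnion₂.1 haA
    obtain ⟨w, hw, hw1, hw2⟩ := Set.mem_iUnion₂.1 haB
    have hp := hP a (hIcc a ha)
    have huw : u < w := ((hp.strictAntiOn_height ha.1).lt_iff_gt hw hu).1 (hw1.trans hu1)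
    exact lt_asymm (hu2.trans hw2) (hp.strictAntiOn_sin ha.1 hu hw huw)
  have hcover : ¬ Set.Ioc (0 : ℝ) 6 ⊆ A ∪ B := fun hsub =>
    hdisj (isPreconnected_Ioc A B hAo hBo hsub hAne hBne)
  obtain ⟨a, ha, hnot⟩ := Set.not_subset.1 hcover
  have haA : a ∉ A := fun h => hnot (Or.inl h)
  have haB : a ∉ B := fun h => hnot (Or.inr h)
  have hp := hP a (hIcc a ha)
  have hneg := hp.height_ten_neg ha.1 ha.2
  have hpos : 0 < F a 0 := by rw [hp.height_zero]; exact ha.1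
  obtain ⟨z, hz, hFz⟩ := intermediate_value_Ioo' (by norm_num : (0 : ℝ) ≤ 10)
    hp.continuous_height.continuousOn ⟨hneg, hpos⟩
  have hzI : z ∈ Set.Icc (0 : ℝ) 10 := ⟨hz.1.le, hz.2.le⟩
  refine ⟨a, z, Q a, F a, m a, ha.1, hp, hz, hFz, ?_⟩
  rcases lt_trichotomy (Q a z) (-(√3 / 2)) with hlt | heq | hgt
  · have h1 : ∀ᶠ u in nhds z, Q a u < -(√3 / 2) :=
      hp.continuous_sin.continuousAt.eventually_lt_const hlt
    obtain ⟨u, hu1, hu2⟩ := ((h1.filter_mono nhdsWithin_le_nhds).and (Ioo_mem_nhdsLT hz.1)).exists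
    have hu : u ∈ Set.Icc (0 : ℝ) 10 := ⟨hu2.1.le, (hu2.2.trans hz.2).le⟩
    have hFu := hp.strictAntiOn_height ha.1 hu hzI hu2.2
    rw [hFz] at hFu
    exact (haA (Set.mem_iUnion₂.2 ⟨u, hu, hFu, hu1⟩)).elim
  · exact heq
  · have h1 : ∀ᶠ u in nhds z, -(√3 / 2) < Q a u :=
      hp.continuous_sin.continuousAt.eventually_const_lt hgt
    obtain ⟨u, hu1, hu2⟩ := ((h1.filter_mono nhdsWithin_le_nhds).and (Ioo_mem_nhdsGT hz.2)).exists
    have hu : u ∈ Set.Icc (0 : ℝ) 10 := ⟨(hz.1.trans hu2.1).le, hu2.2.le⟩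
    have hFu := hp.strictAntiOn_height ha.1 hzI hu hu2.1
    rw [hFz] at hFu
    exact (haB (Set.mem_iUnion₂.2 ⟨u, hu, hFu, hu1⟩)).elim

/-! ### Passage to arc length -/

/-- The autonomous equation `U' = c(U)` is solved by inverting `∫ 1 / c`. -/
theorem exists_strictMono_hasDerivAt {c : ℝ → ℝ} (hc : Continuous c) (hpos : ∀ x, 0 < c x)
    (hle : ∀ x, c x ≤ 1) : ∃ U : ℝ → ℝ, StrictMono U ∧ Function.Surjective U ∧ U 0 = 0 ∧
      ∀ s, HasDerivAt U (c (U s)) s := by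
  set σ : ℝ → ℝ := fun u => ∫ t in (0 : ℝ)..u, (c t)⁻¹ with hσ
  have hd : ∀ u, HasDerivAt σ (c u)⁻¹ u := fun u =>
    ((hc.inv₀ fun x => (hpos x).ne').integral_hasStrictDerivAt 0 u).hasDerivAt
  have hσc : Continuous σ := continuous_iff_continuousAt.2 fun u => (hd u).continuousAt
  have hmono : StrictMono σ := strictMono_of_deriv_pos fun u => by
    rw [(hd u).deriv]; exact inv_pos.2 (hpos u)
  have hd' : ∀ u, HasDerivAt (fun u => σ u - u) ((c u)⁻¹ - 1) u := fun u =>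
    (hd u).sub (hasDerivAt_id u)
  have hmono' : Monotone fun u => σ u - u := by
    refine monotone_of_deriv_nonneg (fun u => (hd' u).differentiableAt) fun u => ?_
    rw [(hd' u).deriv, sub_nonneg]
    exact (one_le_inv₀ (hpos u)).2 (hle u)
  have h0 : σ 0 = 0 := intervalIntegral.integral_same
  have hsurj : Function.Surjective σ := by
    refine hσc.surjective (Filter.tendsto_atTop_mono' _ ?_ Filter.tendsto_id)
      (Filter.tendsto_atBot_mono' _ ?_ Filter.tendsto_id)
    · filter_upwards [Filter.eventually_ge_atTop 0] with u hu
      have := hmono' hu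
      simp only [h0] at this
      simp only [id]; linarith
    · filter_upwards [Filter.eventually_le_atBot 0] with u hu
      have := hmono' hu
      simp only [h0] at this
      simp only [id]; linarith
  let e : ℝ ≃o ℝ := hmono.orderIsoOfSurjective σ hsurj
  have hσe : ∀ s, σ (e.symm s) = s := fun s => e.apply_symm_apply s
  refine ⟨e.symm, e.symm.strictMono, e.symm.surjective, hmono.injective ?_, fun s => ?_⟩
  · rw [hσe, h0]
  · have := HasDerivAt.of_local_left_inverse e.symm.continuous.continuousAt (hd (e.symm s))
      (inv_ne_zero (hpos _).ne') (.of_forall hσe)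
    rwa [inv_inv] at this

theorem contDiffOn_two_of_hasDerivWithinAt {L : ℝ} (hL : 0 < L) {g g₁ g₂ : ℝ → ℝ}
    (h₁ : ∀ s ∈ Set.Icc 0 L, HasDerivWithinAt g (g₁ s) (Set.Icc 0 L) s)
    (h₂ : ∀ s ∈ Set.Icc 0 L, HasDerivWithinAt g₁ (g₂ s) (Set.Icc 0 L) s)
    (hc : ContinuousOn g₂ (Set.Icc 0 L)) :
    ContDiffOn ℝ 2 g (Set.Icc 0 L) ∧ (∀ s ∈ Set.Icc 0 L, derivWithin g (Set.Icc 0 L) s = g₁ s) ∧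
      ∀ s ∈ Set.Icc 0 L, derivWithin (derivWithin g (Set.Icc 0 L)) (Set.Icc 0 L) s = g₂ s := by
  have hu : UniqueDiffOn ℝ (Set.Icc 0 L) := uniqueDiffOn_Icc hL
  have e₁ : ∀ s ∈ Set.Icc 0 L, derivWithin g (Set.Icc 0 L) s = g₁ s := fun s hs =>
    (h₁ s hs).derivWithin (hu s hs)
  have h₂' : ∀ s ∈ Set.Icc 0 L,
      HasDerivWithinAt (derivWithin g (Set.Icc 0 L)) (g₂ s) (Set.Icc 0 L) s := fun s hs =>
    (h₂ s hs).congr e₁ (e₁ s hs)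
  have e₂ : ∀ s ∈ Set.Icc 0 L,
      derivWithin (derivWithin g (Set.Icc 0 L)) (Set.Icc 0 L) s = g₂ s := fun s hs =>
    (h₂' s hs).derivWithin (hu s hs)
  refine ⟨?_, e₁, e₂⟩
  rw [show (2 : WithTop ℕ∞) = 1 + 1 by norm_num, contDiffOn_succ_iff_derivWithin hu]
  refine ⟨fun s hs => (h₁ s hs).differentiableWithinAt, by simp, ?_⟩
  rw [show (1 : WithTop ℕ∞) = 0 + 1 by norm_num, contDiffOn_succ_iff_derivWithin hu]
  refine ⟨fun s hs => (h₂' s hs).differentiableWithinAt, by simp, ?_⟩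
  rw [contDiffOn_zero]
  exact hc.congr e₂

theorem proposition1p3 :
    ∃ (a L : ℝ) (u v : ℝ → ℝ), 0 < a ∧ 0 < L ∧
      -- regularity on the closed interval and the equations
      ContDiffOn ℝ 2 u (Set.Icc 0 L) ∧ ContDiffOn ℝ 2 v (Set.Icc 0 L) ∧
      SolvesProfileSystem L u v ∧
      -- initial point and horizontal initial tangent
      u 0 = 0 ∧ v 0 = a ∧
      derivWithin u (Set.Icc 0 L) 0 = 1 ∧ derivWithin v (Set.Icc 0 L) 0 = 0 ∧
      -- final point on the horizontal axis, at an angle of 60 degrees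
      0 < u L ∧ v L = 0 ∧
      derivWithin u (Set.Icc 0 L) L = 1 / 2 ∧ derivWithin v (Set.Icc 0 L) L = -(√3 / 2) ∧
      -- the curve stays in the open quadrant and does not intersect itself
      (∀ s ∈ Set.Ioo 0 L, 0 < u s ∧ 0 < v s) ∧
      Set.InjOn (fun s => (u s, v s)) (Set.Icc 0 L) := by
  obtain ⟨a, z, q, f, m, ha, hp, hz, hfz, hqz⟩ := exists_clippedProfile_angle
  have hqc := hp.continuous_sin
  obtain ⟨U, hUm, hUs, hU0, hUd⟩ := exists_strictMono_hasDerivAt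
    (continuous_clipCos.comp hqc) (fun x => clipCos_pos _) (fun x => clipCos_le_one _)
  simp only [Function.comp_apply] at hUd
  have hUc : Continuous U := continuous_iff_continuousAt.2 fun s => (hUd s).continuousAt
  obtain ⟨L, hUL⟩ := hUs z
  have hL : 0 < L := hUm.lt_iff_lt.1 (by rw [hU0, hUL]; exact hz.1)
  have hUz : ∀ s ∈ Set.Icc 0 L, U s ∈ Set.Icc 0 z := fun s hs =>
    ⟨hU0 ▸ hUm.monotone hs.1, hUL ▸ hUm.monotone hs.2⟩
  have hU10 : ∀ s ∈ Set.Icc 0 L, U s ∈ Set.Icc (0 : ℝ) 10 := fun s hs =>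
    ⟨(hUz s hs).1, (hUz s hs).2.trans hz.2.le⟩
  have hzI : z ∈ Set.Icc (0 : ℝ) 10 := ⟨hz.1.le, hz.2.le⟩
  have h0I : (0 : ℝ) ∈ Set.Icc (0 : ℝ) 10 := ⟨le_rfl, by norm_num⟩
  -- up to `z` the angle lies between `-60°` and `0`, so that the truncation has no effect
  have hsin : ∀ s ∈ Set.Icc 0 L, clipSin (q (U s)) = q (U s) := by
    intro s hs
    have h1 := (hp.strictAntiOn_sin ha).antitoneOn (hU10 s hs) hzI (hUz s hs).2
    have h2 := (hp.strictAntiOn_sin ha).antitoneOn h0I (hU10 s hs) (hUz s hs).1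
    rw [hqz] at h1
    rw [hp.sin_zero] at h2
    exact clipSin_of_abs_le (abs_le.2 ⟨h1, h2.trans (by positivity)⟩)
  set k : ℝ → ℝ := fun u => u * q u - f u * clipCos (q u) - m u with hk
  have hkc : Continuous k := ((continuous_id.mul hqc).sub
    (hp.continuous_height.mul (continuous_clipCos.comp hqc))).sub hp.continuous_mean
  have hqd : ∀ s ∈ Set.Icc 0 L,
      HasDerivAt (fun s => q (U s)) (k (U s) * clipCos (q (U s))) s := fun s hs =>
    (hp.hasDerivAt_sin (U s) (hU10 s hs)).comp s (hUd s)
  have hcos : ∀ s ∈ Set.Icc 0 L, clipCos (q (U s)) = √(1 - q (U s) ^ 2) := fun s hs => by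
    rw [clipCos, hsin s hs]
  have hcd : ∀ s ∈ Set.Icc 0 L, HasDerivWithinAt (fun s => clipCos (q (U s)))
      (-(q (U s) * k (U s))) (Set.Icc 0 L) s := by
    intro s hs
    have hpos : 0 < √(1 - q (U s) ^ 2) := hcos s hs ▸ clipCos_pos _
    have h1 := (((hqd s hs).pow 2).const_sub 1).sqrt (Real.sqrt_pos.1 hpos).ne'
    refine (h1.hasDerivWithinAt.congr (fun r hr => hcos r hr) (hcos s hs)).congr_deriv ?_
    simp only [Pi.pow_apply]
    rw [hcos s hs]
    field_simp
    ring
  have hvd : ∀ s ∈ Set.Icc 0 L, HasDerivAt (fun s => f (U s)) (q (U s)) s := fun s hs => by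
    have h1 := (hp.hasDerivAt_height (U s) (hU10 s hs)).comp s (hUd s)
    rw [clipTan_mul_clipCos, hsin s hs] at h1
    exact h1
  obtain ⟨hu2, eu1, eu2⟩ := contDiffOn_two_of_hasDerivWithinAt hL
    (fun s _ => (hUd s).hasDerivWithinAt) hcd
    ((hqc.comp hUc).mul (hkc.comp hUc)).neg.continuousOn
  obtain ⟨hv2, ev1, ev2⟩ := contDiffOn_two_of_hasDerivWithinAt hL
    (fun s hs => (hvd s hs).hasDerivWithinAt) (fun s hs => (hqd s hs).hasDerivWithinAt)
    ((hkc.comp hUc).mul (continuous_clipCos.comp (hqc.comp hUc))).continuousOn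
  have h0L : (0 : ℝ) ∈ Set.Icc 0 L := ⟨le_rfl, hL.le⟩
  have hLL : L ∈ Set.Icc 0 L := ⟨hL.le, le_rfl⟩
  refine ⟨a, L, U, fun s => f (U s), ha, hL, hu2, hv2, ?_, hU0, ?_, ?_, ?_, ?_, ?_, ?_, ?_, ?_, ?_⟩
  · intro s hs
    have hs' : s ∈ Set.Icc 0 L := ⟨hs.1.le, hs.2⟩
    have hUpos : 0 < U s := hU0 ▸ hUm hs.1
    rw [eu2 s hs', ev2 s hs', eu1 s hs', ev1 s hs']
    have hm : m (U s) = q (U s) / U s := by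
      rw [hp.sin_eq (U s)]; field_simp
    simp only [hk, hm]
    constructor <;> ring
  · simp only [hU0, hp.height_zero]
  · rw [eu1 0 h0L, hU0, hp.sin_zero, clipCos_zero]
  · rw [ev1 0 h0L, hU0, hp.sin_zero]
  · rw [hUL]; exact hz.1
  · simp only [hUL, hfz]
  · rw [eu1 L hLL, hcos L hLL, hUL, hqz, neg_sq, div_pow, Real.sq_sqrt (by norm_num),
      show (1 : ℝ) - 3 / 2 ^ 2 = (1 / 2) ^ 2 by norm_num, Real.sqrt_sq (by norm_num)]
  · rw [ev1 L hLL, hUL, hqz]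
  · intro s hs
    have hs' : s ∈ Set.Icc 0 L := ⟨hs.1.le, hs.2.le⟩
    refine ⟨hU0 ▸ hUm hs.1, ?_⟩
    have h1 := hp.strictAntiOn_height ha (hU10 s hs') hzI (hUL ▸ hUm hs.2)
    rwa [hfz] at h1
  · exact fun r _ s _ h => hUm.injective (congrArg Prod.fst h)
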